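/- Let $d,k\ge 0$ be integers with $k>d/2$ and let $X\subseteq\mathbb{R}^d$ be a bounded domain (a non-empty, connected, bounded open set). Let $W^{k,2}(X)$ be the Sobolev space of all real $f\in L^2(X)$ whose weak derivatives $D^{\alpha}f$ exist in $L^2(X)$ for every multi-index $\alpha$ with $\|\alpha\|_1\le k$, with the inner product $$\langle f,g\rangle_{W^{k,2}}=\sum_{\|\alpha\|_1\le k}\int_X D^{\alpha}f(x)\,D^{\alpha}g(x)\,dx$$ and the norm $\|f\|_{W^{k,2}}=\langle f,f\rangle_{W^{k,2}}^{1/2}$. Then $W^{k,2}(X)$ is a reproducing kernel Hilbert space on $X$. That is, $W^{k,2}(X)$ is complete; every $f\in W^{k,2}(X)$ has a continuous representative on $X$ (again denoted $f$); for every $x\in X$ there is a constant $M_x>0$ such that $|f(x)|\le M_x\,\|f\|_{W^{k,2}}$ for all $f\in W^{k,2}(X)$; and there is a map $K\colon X\to W^{k,2}(X)$, $x\mapsto K_x$, such that $f(x)=\langle f,K_x\rangle_{W^{k,2}}$ for all $f\in W^{k,2}(X)$ and all $x\in X$. -/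

import Mathlib

open MeasureTheory TopologicalSpace
open scoped ContDiff

noncomputable section

namespace Sobolev

variable {d : ℕ}

/-- The `i`-th partial derivative of a function on `ℝ^d`. -/
def partialDeriv (i : Fin d) (φ : EuclideanSpace ℝ (Fin d) → ℝ) :
    EuclideanSpace ℝ (Fin d) → ℝ :=
  fun x => fderiv ℝ φ x (EuclideanSpace.single i 1)

/-- The classical mixed partial derivative `∂₁^{α₁} ⋯ ∂_d^{α_d} φ`. -/
def mixedPartial (α : Fin d → ℕ) (φ : EuclideanSpace ℝ (Fin d) → ℝ) :
    EuclideanSpace ℝ (Fin d) → ℝ :=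
  (List.finRange d).foldr (fun i ψ => (partialDeriv i)^[α i] ψ) φ

/-- `φ ∈ C_c^∞(X)`: a smooth function with compact support contained in `X`. -/
structure IsTestFunction (X : Opens (EuclideanSpace ℝ (Fin d)))
    (φ : EuclideanSpace ℝ (Fin d) → ℝ) : Prop where
  smooth : ContDiff ℝ ∞ φ
  compact : HasCompactSupport φ
  subset : tsupport φ ⊆ X

/-- The real Hilbert space `L²(X)` with respect to Lebesgue measure. -/
abbrev L2 (X : Opens (EuclideanSpace ℝ (Fin d))) : Type :=
  Lp ℝ 2 (volume.restrict (X : Set (EuclideanSpace ℝ (Fin d))))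

/-- `g` is the weak (distributional) derivative `D^α f` on `X`, for `f, g ∈ L²(X)`. -/
def HasWeakDeriv (X : Opens (EuclideanSpace ℝ (Fin d))) (α : Fin d → ℕ) (f g : L2 X) : Prop :=
  ∀ φ : EuclideanSpace ℝ (Fin d) → ℝ, IsTestFunction X φ →
    ∫ x in (X : Set (EuclideanSpace ℝ (Fin d))), f x * mixedPartial α φ x =
      (-1) ^ (∑ i, α i) * ∫ x in (X : Set (EuclideanSpace ℝ (Fin d))), g x * φ x

/-- The finite set of multi-indices `α` with `|α| = α₁ + ⋯ + α_d ≤ k`. -/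
def multiIndices (d k : ℕ) : Finset (Fin d → ℕ) :=
  (Fintype.piFinset fun _ => Finset.range (k + 1)).filter fun α => ∑ i, α i ≤ k

theorem mem_multiIndices {k : ℕ} {α : Fin d → ℕ} :
    α ∈ multiIndices d k ↔ ∑ i, α i ≤ k := by
  simp only [multiIndices, Finset.mem_filter, Fintype.mem_piFinset, Finset.mem_range,
    and_iff_right_iff_imp]
  intro h i
  have := Finset.single_le_sum (f := α) (fun j _ => Nat.zero_le _) (Finset.mem_univ i)
  omega

theorem contDiff_partialDeriv {φ : EuclideanSpace ℝ (Fin d) → ℝ} (i : Fin d)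
    (h : ContDiff ℝ ∞ φ) : ContDiff ℝ ∞ (partialDeriv i φ) := by
  unfold partialDeriv
  exact (h.fderiv_right (by simp)).clm_apply contDiff_const

theorem tsupport_partialDeriv_subset {φ : EuclideanSpace ℝ (Fin d) → ℝ} (i : Fin d) :
    tsupport (partialDeriv i φ) ⊆ tsupport φ :=
  tsupport_fderiv_apply_subset ℝ _

theorem IsTestFunction.partialDeriv {X : Opens (EuclideanSpace ℝ (Fin d))}
    {φ : EuclideanSpace ℝ (Fin d) → ℝ} (h : IsTestFunction X φ) (i : Fin d) :
    IsTestFunction X (partialDeriv i φ) :=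
  ⟨contDiff_partialDeriv i h.smooth, h.compact.of_isClosed_subset (isClosed_tsupport _)
    (tsupport_partialDeriv_subset i), (tsupport_partialDeriv_subset i).trans h.subset⟩

theorem IsTestFunction.mixedPartial {X : Opens (EuclideanSpace ℝ (Fin d))}
    {φ : EuclideanSpace ℝ (Fin d) → ℝ} (h : IsTestFunction X φ) (α : Fin d → ℕ) :
    IsTestFunction X (mixedPartial α φ) := by
  unfold Sobolev.mixedPartial
  induction List.finRange d with
  | nil => exact h
  | cons i l ih =>
    rw [List.foldr_cons]
    induction α i with
    | zero => exact ih
    | succ n ihn => rw [Function.iterate_succ_apply']; exact ihn.partialDeriv i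

theorem IsTestFunction.integrable_mul {X : Opens (EuclideanSpace ℝ (Fin d))}
    {φ : EuclideanSpace ℝ (Fin d) → ℝ} (h : IsTestFunction X φ) (f : L2 X) :
    Integrable (fun x => f x * φ x) (volume.restrict (X : Set (EuclideanSpace ℝ (Fin d)))) := by
  have hφ : MemLp φ 2 (volume.restrict (X : Set (EuclideanSpace ℝ (Fin d)))) :=
    (h.smooth.continuous.memLp_of_hasCompactSupport h.compact).restrict _
  exact (Lp.memLp f).integrable_mul hφ

theorem HasWeakDeriv.unique {X : Opens (EuclideanSpace ℝ (Fin d))} {α : Fin d → ℕ}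
    {f g g' : L2 X} (h : HasWeakDeriv X α f g) (h' : HasWeakDeriv X α f g') : g = g' := by
  have hloc : ∀ u : L2 X, LocallyIntegrableOn u (X : Set (EuclideanSpace ℝ (Fin d))) volume := by
    intro u
    rw [locallyIntegrableOn_iff X.isOpen.isLocallyClosed]
    intro K hK hKc
    have h1 : MemLp u 2 (volume.restrict K) :=
      (Lp.memLp u).mono_measure (Measure.restrict_mono hK le_rfl)
    have : IsFiniteMeasure (volume.restrict K) := ⟨by simpa using hKc.measure_lt_top⟩
    exact h1.integrable (by norm_num)
  have key := X.isOpen.ae_eq_zero_of_integral_contDiff_smul_eq_zero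
    ((hloc g).sub (hloc g')) (by
      intro φ hφ hc hs
      have ht : IsTestFunction X φ := ⟨hφ, hc, hs⟩
      have e := (h φ ht).symm.trans (h' φ ht)
      have e2 := mul_left_cancel₀ (pow_ne_zero _ (by norm_num : (-1 : ℝ) ≠ 0)) e
      have e3 : ∫ x in (X : Set (EuclideanSpace ℝ (Fin d))), φ x • (g x - g' x) = 0 := by
        have : ∀ x, φ x • (g x - g' x) = g x * φ x - g' x * φ x := by
          intro x; simp only [smul_eq_mul]; ring
        simp_rw [this]
        rw [integral_sub (ht.integrable_mul g) (ht.integrable_mul g'), e2, sub_self]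
      rw [← e3]
      refine (setIntegral_eq_integral_of_forall_compl_eq_zero fun x hx => ?_).symm
      have : φ x = 0 := image_eq_zero_of_notMem_tsupport fun hx' => hx (hs hx')
      simp [this])
  apply Lp.ext
  rw [Filter.EventuallyEq, ae_restrict_iff' X.isOpen.measurableSet]
  filter_upwards [key] with x hx hxX
  exact sub_eq_zero.mp (hx hxX)

theorem HasWeakDeriv.add {X : Opens (EuclideanSpace ℝ (Fin d))} {α : Fin d → ℕ}
    {f f' g g' : L2 X} (h : HasWeakDeriv X α f g) (h' : HasWeakDeriv X α f' g') :
    HasWeakDeriv X α (f + f') (g + g') := by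
  have aux : ∀ (u v : L2 X) (φ : EuclideanSpace ℝ (Fin d) → ℝ), IsTestFunction X φ →
      ∫ x in (X : Set (EuclideanSpace ℝ (Fin d))), (u + v : L2 X) x * φ x =
        (∫ x in (X : Set (EuclideanSpace ℝ (Fin d))), u x * φ x) +
          ∫ x in (X : Set (EuclideanSpace ℝ (Fin d))), v x * φ x := by
    intro u v φ hφ
    rw [← integral_add (hφ.integrable_mul u) (hφ.integrable_mul v)]
    apply integral_congr_ae
    filter_upwards [Lp.coeFn_add u v] with x hx
    rw [hx, Pi.add_apply, add_mul]
  intro φ hφ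
  rw [aux _ _ _ (hφ.mixedPartial α), aux _ _ _ hφ, h φ hφ, h' φ hφ, mul_add]

theorem HasWeakDeriv.smul {X : Opens (EuclideanSpace ℝ (Fin d))} {α : Fin d → ℕ}
    {f g : L2 X} (c : ℝ) (h : HasWeakDeriv X α f g) : HasWeakDeriv X α (c • f) (c • g) := by
  have aux : ∀ (u : L2 X) (φ : EuclideanSpace ℝ (Fin d) → ℝ),
      ∫ x in (X : Set (EuclideanSpace ℝ (Fin d))), (c • u : L2 X) x * φ x =
        c * ∫ x in (X : Set (EuclideanSpace ℝ (Fin d))), u x * φ x := by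
    intro u φ
    rw [← integral_const_mul]
    apply integral_congr_ae
    filter_upwards [Lp.coeFn_smul c u] with x hx
    rw [hx, Pi.smul_apply, smul_eq_mul, mul_assoc]
  intro φ hφ
  rw [aux, aux, h φ hφ]
  ring

theorem hasWeakDeriv_zero_index (X : Opens (EuclideanSpace ℝ (Fin d))) (f : L2 X) :
    HasWeakDeriv X 0 f f := by
  intro φ _
  have : mixedPartial (0 : Fin d → ℕ) φ = φ := by
    unfold mixedPartial
    induction List.finRange d with
    | nil => rfl
    | cons i l ih => rw [List.foldr_cons, ih]; rfl
  simp [this]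

theorem hasWeakDeriv_zero (X : Opens (EuclideanSpace ℝ (Fin d))) (α : Fin d → ℕ) :
    HasWeakDeriv X α 0 0 := by
  intro φ _
  have aux : ∀ ψ : EuclideanSpace ℝ (Fin d) → ℝ,
      ∫ x in (X : Set (EuclideanSpace ℝ (Fin d))), (0 : L2 X) x * ψ x = 0 := by
    intro ψ
    apply integral_eq_zero_of_ae
    filter_upwards [Lp.coeFn_zero ℝ 2
      (volume.restrict (X : Set (EuclideanSpace ℝ (Fin d))))] with x hx
    rw [hx, Pi.zero_apply, zero_mul]
  rw [aux, aux, mul_zero]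

/-- The linear space of all `f ∈ L²(X)` whose weak derivatives `D^α f`, `|α| ≤ k`, exist and lie
in `L²(X)`. -/
def sobolevSubmodule (k : ℕ) (X : Opens (EuclideanSpace ℝ (Fin d))) : Submodule ℝ (L2 X) where
  carrier := {f | ∀ α : Fin d → ℕ, ∑ i, α i ≤ k → ∃ g : L2 X, HasWeakDeriv X α f g}
  add_mem' := fun hf hg α hα =>
    ⟨_, (hf α hα).choose_spec.add (hg α hα).choose_spec⟩
  zero_mem' := fun α _ => ⟨0, hasWeakDeriv_zero X α⟩
  smul_mem' := fun c _ hf α hα => ⟨_, (hf α hα).choose_spec.smul c⟩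

/-- The Sobolev space `W^{k,2}(X)`. It is a type synonym of the submodule above, so that it
carries the Sobolev norm and not the norm of `L²(X)`. -/
def SobolevSpace (k : ℕ) (X : Opens (EuclideanSpace ℝ (Fin d))) : Type :=
  ↥(sobolevSubmodule k X)

namespace SobolevSpace

variable {k : ℕ} {X : Opens (EuclideanSpace ℝ (Fin d))}

instance : AddCommGroup (SobolevSpace k X) :=
  inferInstanceAs (AddCommGroup ↥(sobolevSubmodule k X))

instance : Module ℝ (SobolevSpace k X) :=
  inferInstanceAs (Module ℝ ↥(sobolevSubmodule k X))

/-- The inclusion `W^{k,2}(X) → L²(X)`. -/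
def toL2 : SobolevSpace k X →ₗ[ℝ] L2 X := (sobolevSubmodule k X).subtype

theorem toL2_injective : Function.Injective (toL2 : SobolevSpace k X → L2 X) :=
  Subtype.val_injective

open Classical in
/-- The weak derivative `D^α f ∈ L²(X)` of `f ∈ W^{k,2}(X)`, for `|α| ≤ k` (and `0` if it does
not exist, which can happen only for `|α| > k`). -/
def weakDeriv (α : Fin d → ℕ) (f : SobolevSpace k X) : L2 X :=
  if h : ∃ g : L2 X, HasWeakDeriv X α (toL2 f) g then h.choose else 0

theorem hasWeakDeriv_weakDeriv {α : Fin d → ℕ} (hα : ∑ i, α i ≤ k) (f : SobolevSpace k X) :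
    HasWeakDeriv X α (toL2 f) (weakDeriv α f) := by
  have h : ∃ g : L2 X, HasWeakDeriv X α (toL2 f) g := f.2 α hα
  rw [weakDeriv, dif_pos h]
  exact h.choose_spec

theorem weakDeriv_add {α : Fin d → ℕ} (hα : ∑ i, α i ≤ k) (f g : SobolevSpace k X) :
    weakDeriv α (f + g) = weakDeriv α f + weakDeriv α g :=
  (hasWeakDeriv_weakDeriv hα (f + g)).unique
    (by rw [map_add]; exact (hasWeakDeriv_weakDeriv hα f).add (hasWeakDeriv_weakDeriv hα g))

theorem weakDeriv_smul {α : Fin d → ℕ} (hα : ∑ i, α i ≤ k) (c : ℝ) (f : SobolevSpace k X) :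
    weakDeriv α (c • f) = c • weakDeriv α f :=
  (hasWeakDeriv_weakDeriv hα (c • f)).unique
    (by rw [map_smul]; exact (hasWeakDeriv_weakDeriv hα f).smul c)

theorem weakDeriv_zero (f : SobolevSpace k X) : weakDeriv 0 f = toL2 f :=
  (hasWeakDeriv_weakDeriv (by simp) f).unique (hasWeakDeriv_zero_index X _)

/-- The inner product `⟨f, g⟩ = ∑_{|α| ≤ k} ∫_X D^α f(x) · D^α g(x) dx`. -/
def sobolevInner (f g : SobolevSpace k X) : ℝ :=
  ∑ α ∈ multiIndices d k,
    ∫ x in (X : Set (EuclideanSpace ℝ (Fin d))), weakDeriv α f x * weakDeriv α g x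

theorem sobolevInner_eq (f g : SobolevSpace k X) :
    sobolevInner f g = ∑ α ∈ multiIndices d k, inner ℝ (weakDeriv α f) (weakDeriv α g) := by
  simp only [sobolevInner, MeasureTheory.L2.inner_def, RCLike.inner_apply, conj_trivial, mul_comm]

/-- The laws of the inner product. -/
@[reducible]
def innerCore (k : ℕ) (X : Opens (EuclideanSpace ℝ (Fin d))) :
    InnerProductSpace.Core ℝ (SobolevSpace k X) where
  inner := sobolevInner
  conj_inner_symm := fun f g => by
    simp only [sobolevInner, conj_trivial, mul_comm]
  re_inner_nonneg := fun f => by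
    rw [sobolevInner_eq]
    exact Finset.sum_nonneg fun α _ => real_inner_self_nonneg
  add_left := fun f g h => by
    simp only [sobolevInner_eq]
    rw [← Finset.sum_add_distrib]
    refine Finset.sum_congr rfl fun α hα => ?_
    rw [weakDeriv_add (mem_multiIndices.mp hα), inner_add_left]
  smul_left := fun f g c => by
    simp only [sobolevInner_eq]
    rw [Finset.mul_sum]
    refine Finset.sum_congr rfl fun α hα => ?_
    rw [weakDeriv_smul (mem_multiIndices.mp hα), inner_smul_left]
  definite := fun f hf => by
    rw [sobolevInner_eq, Finset.sum_eq_zero_iff_of_nonneg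
      (fun α _ => real_inner_self_nonneg)] at hf
    have h0 := hf 0 (mem_multiIndices.mpr (by simp))
    rw [inner_self_eq_zero, weakDeriv_zero] at h0
    exact toL2_injective (by rw [h0, map_zero])

instance : NormedAddCommGroup (SobolevSpace k X) :=
  (innerCore k X).toNormedAddCommGroup

instance : InnerProductSpace ℝ (SobolevSpace k X) :=
  InnerProductSpace.ofCore (innerCore k X).toCore

end SobolevSpace

end Sobolev

end

/-! ### Completeness of the Sobolev space. -/

namespace Sobolev

/-! Completeness: `weakDerivs` embeds the space isometrically in a finite product of copies of L².
Its range is closed, because the relation "g is the weak derivative of f" is tested by functionals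
continuous on L².

Continuity is a local matter, so no regularity of the boundary is needed. Multiply `f` by a bump `χ`
and extend by zero to `u`. By the Leibniz rule the pure derivatives `∂ᵢᵏ u` are in L², hence so are
`ξᵢᵏ 𝓕 u` and `(1 + ‖ξ‖)ᵏ 𝓕 u`. As `2k > d`, the weight `(1 + ‖ξ‖)⁻ᵏ` is in L², so `𝓕 u` is in L¹ by
Cauchy–Schwarz, and Fourier inversion gives a continuous function equal to `u` almost everywhere
(`exists_continuous_ae_eq_ball`). The local representatives are then glued.

No quantitative Sobolev inequality is used for the bound on evaluation. The value at `x` is the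
limit of averages over shrinking balls (`tendsto_average_ball`); each average is a continuous
functional, so by completeness and Banach–Steinhaus the limit is continuous too. The kernel then
comes from Riesz representation. -/

theorem IsTestFunction.continuous_integral_mul {d : ℕ} {X : Opens (EuclideanSpace ℝ (Fin d))}
    {φ : EuclideanSpace ℝ (Fin d) → ℝ} (h : IsTestFunction X φ) :
    Continuous fun f : L2 X => ∫ x in (X : Set (EuclideanSpace ℝ (Fin d))), f x * φ x := by
  have hφ : MemLp φ 2 (volume.restrict (X : Set (EuclideanSpace ℝ (Fin d)))) :=
    (h.smooth.continuous.memLp_of_hasCompactSupport h.compact).restrict _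
  have key : ∀ f : L2 X, ∫ x in (X : Set (EuclideanSpace ℝ (Fin d))), f x * φ x =
      inner ℝ (hφ.toLp φ) f := by
    intro f
    rw [MeasureTheory.L2.inner_def]
    refine integral_congr_ae ?_
    filter_upwards [hφ.coeFn_toLp] with x hx
    simp [hx]
  simp_rw [key]
  fun_prop

theorem isClosed_setOf_hasWeakDeriv {d : ℕ} (X : Opens (EuclideanSpace ℝ (Fin d)))
    (α : Fin d → ℕ) : IsClosed {p : L2 X × L2 X | HasWeakDeriv X α p.1 p.2} := by
  simp only [HasWeakDeriv, Set.ofPred_forall]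
  refine isClosed_iInter fun φ => isClosed_iInter fun hφ => isClosed_eq ?_ ?_
  · exact (hφ.mixedPartial α).continuous_integral_mul.comp continuous_fst
  · exact continuous_const.mul (hφ.continuous_integral_mul.comp continuous_snd)

namespace SobolevSpace

variable {d k : ℕ} {X : Opens (EuclideanSpace ℝ (Fin d))}

theorem norm_sq_eq_sum_weakDeriv (f : SobolevSpace k X) :
    ‖f‖ ^ 2 = ∑ α ∈ multiIndices d k, ‖weakDeriv α f‖ ^ 2 := by
  rw [← real_inner_self_eq_norm_sq]
  simp_rw [← real_inner_self_eq_norm_sq]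
  exact sobolevInner_eq f f

/-- The isometric embedding of `W^{k,2}(X)` into the product of copies of `L²(X)` that sends `f`
to the family of its weak derivatives. -/
noncomputable def weakDerivs :
    SobolevSpace k X →ₗᵢ[ℝ] PiLp 2 fun _ : multiIndices d k => L2 X where
  toFun f := WithLp.toLp 2 fun α => weakDeriv α.1 f
  map_add' f g := by
    ext1 α
    exact weakDeriv_add (mem_multiIndices.mp α.2) f g
  map_smul' c f := by
    ext1 α
    exact weakDeriv_smul (mem_multiIndices.mp α.2) c f
  norm_map' f := by
    rw [← sq_eq_sq₀ (norm_nonneg _) (norm_nonneg _), norm_sq_eq_sum_weakDeriv,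
      PiLp.norm_sq_eq_of_L2]
    exact Finset.sum_coe_sort (multiIndices d k) fun α => ‖weakDeriv α f‖ ^ 2

theorem weakDerivs_apply (f : SobolevSpace k X) (α : multiIndices d k) :
    weakDerivs f α = weakDeriv α.1 f := rfl

/-- A family in the intersection is determined by its entry at index `0`: that entry lies in the
Sobolev space, and uniqueness of weak derivatives identifies all the others. -/
theorem range_weakDerivs :
    Set.range (weakDerivs : SobolevSpace k X → PiLp 2 fun _ : multiIndices d k => L2 X) =
      ⋂ α : multiIndices d k, {g | HasWeakDeriv X α.1 (g ⟨0, mem_multiIndices.mpr (by simp)⟩)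
        (g α)} := by
  ext g
  simp only [Set.mem_range, Set.mem_iInter, Set.mem_ofPred_eq]
  constructor
  · rintro ⟨f, rfl⟩ α
    rw [weakDerivs_apply, weakDerivs_apply, weakDeriv_zero]
    exact hasWeakDeriv_weakDeriv (mem_multiIndices.mp α.2) f
  · intro h
    let f : SobolevSpace k X := ⟨g ⟨0, mem_multiIndices.mpr (by simp)⟩,
      fun α hα => ⟨_, h ⟨α, mem_multiIndices.mpr hα⟩⟩⟩
    refine ⟨f, ?_⟩
    ext1 α
    exact (hasWeakDeriv_weakDeriv (mem_multiIndices.mp α.2) f).unique (h α)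

instance completeSpace : CompleteSpace (SobolevSpace k X) := by
  rw [completeSpace_iff_isComplete_range
    (weakDerivs : SobolevSpace k X →ₗᵢ[ℝ] _).isometry.isUniformInducing, range_weakDerivs]
  refine (isClosed_iInter fun α => ?_).isComplete
  exact (isClosed_setOf_hasWeakDeriv X α.1).preimage
    ((PiLp.continuous_apply 2 (fun _ : multiIndices d k => L2 X) _).prodMk
      (PiLp.continuous_apply 2 (fun _ : multiIndices d k => L2 X) α))

theorem norm_toL2_le (f : SobolevSpace k X) : ‖toL2 f‖ ≤ ‖f‖ := by
  refine le_of_sq_le_sq ?_ (norm_nonneg f)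
  rw [norm_sq_eq_sum_weakDeriv, ← weakDeriv_zero]
  exact Finset.single_le_sum (f := fun α => ‖weakDeriv α f‖ ^ 2) (fun α _ => sq_nonneg _)
    (mem_multiIndices.mpr (by simp))

theorem continuous_toL2 : Continuous (toL2 : SobolevSpace k X → L2 X) :=
  (toL2.mkContinuous 1 fun f => by simpa using norm_toL2_le f).continuous

end SobolevSpace

end Sobolev

/-! ### Fourier transform on L¹ ∩ L² and inversion almost everywhere. -/

section Fourier

open FourierTransform

variable {V : Type*} [NormedAddCommGroup V] [InnerProductSpace ℝ V] [FiniteDimensional ℝ V]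
  [MeasurableSpace V] [BorelSpace V]

theorem Real.continuous_fourier {u : V → ℂ} (hu : Integrable u) : Continuous (𝓕 u) :=
  VectorFourier.fourierIntegral_continuous Real.continuous_fourierChar continuous_inner hu

theorem Real.continuous_fourierInv {u : V → ℂ} (hu : Integrable u) : Continuous (𝓕⁻ u) := by
  rw [Real.fourierInv_eq_fourier_comp_neg]
  exact Real.continuous_fourier hu.comp_neg

theorem Real.integral_fourier_mul {u v : V → ℂ} (hu : Integrable u) (hv : Integrable v) :
    ∫ ξ, 𝓕 u ξ * v ξ = ∫ x, u x * 𝓕 v x := by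
  simpa using! VectorFourier.integral_fourierIntegral_smul_eq_flip (L := innerₗ V)
    Real.continuous_fourierChar continuous_inner hu hv

omit [FiniteDimensional ℝ V] [MeasurableSpace V] [BorelSpace V] in
/-- The complex-valued Schwartz function given by a real-valued test function. -/
theorem exists_schwartzMap_eq_ofReal {g : V → ℝ} (hg : ContDiff ℝ ∞ g) (hc : HasCompactSupport g) :
    ∃ φ : SchwartzMap V ℂ, ∀ x, φ x = (g x : ℂ) :=
  ⟨HasCompactSupport.toSchwartzMap (f := fun x => (g x : ℂ))
    (hc.comp_left (g := fun t : ℝ => (t : ℂ)) Complex.ofReal_zero)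
    (Complex.ofRealCLM.contDiff.comp hg), fun _ => rfl⟩

/-- Plancherel's theorem, qualitatively: the Fourier integral of a function in `L¹ ∩ L²` is in
`L²`. -/
theorem MeasureTheory.MemLp.fourier_two {u : V → ℂ} (hu : Integrable u) (hu2 : MemLp u 2) :
    MemLp (𝓕 u) 2 := by
  -- The L² transform `v` is identified with the Fourier integral by testing: both transforms move
  -- onto `φ`, one by the definition for tempered distributions, the other by the multiplication
  -- formula.
  set v : Lp ℂ 2 (volume : Measure V) := 𝓕 (hu2.toLp u) with hv
  have key : ∀ᵐ ξ, v ξ = 𝓕 u ξ := by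
    refine ae_eq_of_integral_contDiff_smul_eq
      ((Lp.memLp v).locallyIntegrable (by norm_num))
      (Real.continuous_fourier hu).locallyIntegrable fun g hg hc => ?_
    obtain ⟨φ, hφ⟩ := exists_schwartzMap_eq_ofReal hg hc
    have h1 := DFunLike.congr_fun (Lp.fourier_toTemperedDistribution_eq (hu2.toLp u)) φ
    rw [TemperedDistribution.fourier_apply, Lp.toTemperedDistribution_apply,
      Lp.toTemperedDistribution_apply] at h1
    calc ∫ ξ, g ξ • v ξ = ∫ ξ, φ ξ • v ξ := by simp [hφ]
      _ = ∫ x, (𝓕 φ) x • (hu2.toLp u) x := h1.symm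
      _ = ∫ x, (𝓕 φ) x * u x := by
        refine integral_congr_ae ?_
        filter_upwards [hu2.coeFn_toLp] with x hx
        rw [hx, smul_eq_mul]
      _ = ∫ ξ, φ ξ * 𝓕 u ξ := by
        rw [SchwartzMap.fourier_coe]
        exact Real.integral_fourier_mul φ.integrable hu
      _ = ∫ ξ, g ξ • 𝓕 u ξ := by simp [hφ]
  exact (memLp_congr_ae key).mp (Lp.memLp v)

/-- Fourier inversion almost everywhere. -/
theorem MeasureTheory.Integrable.fourierInv_fourier_ae_eq {u : V → ℂ} (hu : Integrable u)
    (hu' : Integrable (𝓕 u)) : 𝓕⁻ (𝓕 u) =ᵐ[volume] u := by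
  refine ae_eq_of_integral_contDiff_smul_eq
    (Real.continuous_fourierInv hu').locallyIntegrable hu.locallyIntegrable fun g hg hc => ?_
  obtain ⟨φ, hφ⟩ := exists_schwartzMap_eq_ofReal hg hc
  -- Two uses of the multiplication formula move both transforms onto `φ`, where inversion is known
  -- for Schwartz functions.
  obtain ⟨ψ, hψ⟩ : ∃ ψ : SchwartzMap V ℂ, ψ = 𝓕⁻ φ := ⟨_, rfl⟩
  have e : 𝓕 ψ = φ := hψ ▸ FourierTransform.fourier_fourierInv_eq φ
  have e' : ∀ ξ, ψ ξ = 𝓕 φ (-ξ) := fun ξ => by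
    rw [hψ, SchwartzMap.fourierInv_coe, Real.fourierInv_eq_fourier_neg, SchwartzMap.fourier_coe]
  calc ∫ x, g x • 𝓕⁻ (𝓕 u) x = ∫ x, φ x * 𝓕 (fun ξ => 𝓕 u (-ξ)) x := by
        simp [hφ, Real.fourierInv_eq_fourier_comp_neg]
    _ = ∫ ξ, 𝓕 φ ξ * 𝓕 u (-ξ) := by
        rw [SchwartzMap.fourier_coe]
        exact (Real.integral_fourier_mul φ.integrable hu'.comp_neg).symm
    _ = ∫ ξ, ψ ξ * 𝓕 u ξ := by
        rw [← integral_neg_eq_self]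
        simp only [neg_neg, e']
    _ = ∫ x, 𝓕 ψ x * u x := by
        rw [SchwartzMap.fourier_coe]
        exact (Real.integral_fourier_mul ψ.integrable hu).symm
    _ = ∫ x, g x • u x := by simp [hφ, e]

end Fourier

/-! ### From weighted L² bounds to integrability. -/

open Module in
/-- A weighted `L²` bound of order `k > d / 2` implies integrability. -/
theorem MeasureTheory.Integrable.of_memLp_two_pow_mul {d k : ℕ} (hk : d < 2 * k)
    {F : EuclideanSpace ℝ (Fin d) → ℂ} (hF : MemLp F 2)
    (hFk : ∀ i, MemLp (fun ξ => ((ξ i ^ k : ℝ) : ℂ) * F ξ) 2) : Integrable F := by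
  -- Here `k ≥ 1`, and `n = k - 1` is the exponent of the constants in both power-mean inequalities
  -- below.
  obtain ⟨n, rfl⟩ : ∃ n, k = n + 1 := ⟨k - 1, by omega⟩
  have hw : MemLp (fun ξ : EuclideanSpace ℝ (Fin d) => (1 + ‖ξ‖) ^ (-((n + 1 : ℕ) : ℝ))) 2 := by
    rw [memLp_two_iff_integrable_sq (Continuous.aestronglyMeasurable
      (Continuous.rpow_const (by fun_prop) fun ξ => Or.inl (by positivity)))]
    have hr : (finrank ℝ (EuclideanSpace ℝ (Fin d)) : ℝ) < 2 * ((n + 1 : ℕ) : ℝ) := by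
      rw [finrank_euclideanSpace_fin]
      exact_mod_cast hk
    refine (integrable_one_add_norm hr).congr (.of_forall fun ξ => ?_)
    simp only
    rw [← Real.rpow_natCast, ← Real.rpow_mul (by positivity)]
    congr 1
    push_cast
    ring
  have hG : MemLp (fun ξ => 2 ^ n * (‖F ξ‖ + d ^ n * ∑ i, ‖((ξ i ^ (n + 1) : ℝ) : ℂ) * F ξ‖)) 2 :=
    (hF.norm.add ((memLp_finsetSum Finset.univ fun i _ => (hFk i).norm).const_mul _)).const_mul _
  refine (hw.integrable_mul hG).mono' hF.1 (.of_forall fun ξ => ?_)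
  have hpos : 0 < (1 + ‖ξ‖) ^ (n + 1) := by positivity
  have h1 : (1 + ‖ξ‖) ^ (n + 1) ≤ 2 ^ n * (1 + ‖ξ‖ ^ (n + 1)) := by
    simpa using add_pow_le (zero_le_one (α := ℝ)) (norm_nonneg ξ) (n + 1)
  have h2 : ‖ξ‖ ≤ ∑ i, |ξ i| := by
    conv_lhs => rw [← (EuclideanSpace.basisFun (Fin d) ℝ).sum_repr ξ]
    refine (norm_sum_le _ _).trans (le_of_eq ?_)
    simp [norm_smul]
  have h3 : (∑ i, |ξ i|) ^ (n + 1) ≤ d ^ n * ∑ i, |ξ i| ^ (n + 1) := by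
    -- In dimension `0` the mean inequality would divide by zero; both sums are then empty.
    rcases Nat.eq_zero_or_pos d with rfl | hd
    · simp
    · have := pow_sum_div_card_le_sum_pow (s := Finset.univ) (f := fun i => |ξ i|)
        (fun i _ => abs_nonneg _) n
      rw [Finset.card_univ, Fintype.card_fin, div_le_iff₀ (by positivity)] at this
      linarith
  simp only [Pi.mul_apply, Real.rpow_neg (by positivity : 0 ≤ 1 + ‖ξ‖), Real.rpow_natCast]
  rw [inv_mul_eq_div, le_div_iff₀ hpos]
  have h4 : ‖ξ‖ ^ (n + 1) ≤ d ^ n * ∑ i, |ξ i| ^ (n + 1) :=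
    (pow_le_pow_left₀ (norm_nonneg _) h2 _).trans h3
  calc ‖F ξ‖ * (1 + ‖ξ‖) ^ (n + 1)
      ≤ ‖F ξ‖ * (2 ^ n * (1 + d ^ n * ∑ i, |ξ i| ^ (n + 1))) := by
        gcongr
        exact h1.trans (by gcongr)
    _ = _ := by
        simp only [norm_mul, Complex.norm_real, Real.norm_eq_abs, abs_pow, ← Finset.sum_mul]
        ring

namespace Sobolev

/-! ### Plane waves and the transform of a derivative. -/

section Waves

open FourierTransform

variable {d : ℕ}

/-- The plane wave of frequency `ξ` and phase `θ`. -/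
noncomputable def planeWave (ξ : EuclideanSpace ℝ (Fin d)) (θ : ℝ) (x : EuclideanSpace ℝ (Fin d)) :
    ℝ :=
  Real.cos (2 * Real.pi * inner ℝ x ξ + θ)

theorem contDiff_planeWave (ξ : EuclideanSpace ℝ (Fin d)) (θ : ℝ) :
    ContDiff ℝ ∞ (planeWave ξ θ) := by
  unfold planeWave
  exact ((contDiff_const.mul (contDiff_id.inner ℝ contDiff_const)).add contDiff_const).cos

theorem abs_planeWave_le_one (ξ : EuclideanSpace ℝ (Fin d)) (θ : ℝ)
    (x : EuclideanSpace ℝ (Fin d)) : |planeWave ξ θ x| ≤ 1 :=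
  Real.abs_cos_le_one _

theorem partialDeriv_const_mul (i : Fin d) (c : ℝ) {φ : EuclideanSpace ℝ (Fin d) → ℝ}
    (hφ : ContDiff ℝ ∞ φ) :
    partialDeriv i (fun x => c * φ x) = fun x => c * partialDeriv i φ x := by
  ext x
  simp only [partialDeriv]
  rw [fderiv_const_mul (hφ.differentiable (by simp) x)]
  rfl

/-- Differentiating a cosine shifts its phase by `π / 2`, so real plane waves with a free phase are
stable under `∂ᵢ` up to scalars. -/
theorem partialDeriv_planeWave (i : Fin d) (ξ : EuclideanSpace ℝ (Fin d)) (θ : ℝ) :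
    partialDeriv i (planeWave ξ θ) =
      fun x => 2 * Real.pi * ξ i * planeWave ξ (θ + Real.pi / 2) x := by
  ext x
  have h : HasFDerivAt (fun x : EuclideanSpace ℝ (Fin d) => 2 * Real.pi * inner ℝ x ξ + θ)
      ((2 * Real.pi) • (innerSL ℝ ξ)) x := by
    simp_rw [real_inner_comm]
    exact (((innerSL ℝ ξ).hasFDerivAt).const_mul _).add_const _
  have h' := h.cos
  simp only [partialDeriv]
  rw [show planeWave ξ θ = fun x => Real.cos (2 * Real.pi * inner ℝ x ξ + θ) from rfl, h'.fderiv]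
  simp only [planeWave, ← add_assoc, Real.cos_add_pi_div_two]
  simp [EuclideanSpace.inner_single_right]
  ring

theorem iterate_partialDeriv_planeWave (i : Fin d) (ξ : EuclideanSpace ℝ (Fin d)) (θ : ℝ) (n : ℕ) :
    (partialDeriv i)^[n] (planeWave ξ θ) =
      fun x => (2 * Real.pi * ξ i) ^ n * planeWave ξ (θ + n * (Real.pi / 2)) x := by
  induction n with
  | zero => simp
  | succ n ih =>
    rw [Function.iterate_succ_apply', ih, partialDeriv_const_mul i _ (contDiff_planeWave _ _),
      partialDeriv_planeWave]
    ext x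
    rw [show θ + (n + 1 : ℕ) * (Real.pi / 2) = θ + n * (Real.pi / 2) + Real.pi / 2 by
      push_cast; ring]
    ring

theorem integrable_mul_planeWave {u : EuclideanSpace ℝ (Fin d) → ℝ} (hu : Integrable u)
    (ξ : EuclideanSpace ℝ (Fin d)) (θ : ℝ) : Integrable fun x => u x * planeWave ξ θ x :=
  hu.mul_bdd (c := 1) (contDiff_planeWave ξ θ).continuous.aestronglyMeasurable
    (.of_forall fun x => abs_planeWave_le_one ξ θ x)

/-- Two real waves a quarter period apart combine to the complex exponential, so real test functions
recover the Fourier integral. -/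
theorem integral_mul_planeWave_add {u : EuclideanSpace ℝ (Fin d) → ℝ} (hu : Integrable u)
    (ξ : EuclideanSpace ℝ (Fin d)) (θ : ℝ) :
    ((∫ x, u x * planeWave ξ θ x : ℝ) : ℂ) +
        Complex.I * ((∫ x, u x * planeWave ξ (θ + Real.pi / 2) x : ℝ) : ℂ) =
      Complex.exp (-θ * Complex.I) * 𝓕 (fun x => (u x : ℂ)) ξ := by
  rw [Real.fourier_eq', ← integral_const_mul, ← integral_complex_ofReal, ← integral_complex_ofReal,
    ← integral_const_mul, ← integral_add]
  · congr 1
    ext x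
    have : Complex.exp (-θ * Complex.I) * Complex.exp (↑(-2 * Real.pi * inner ℝ x ξ) * Complex.I) =
        ((planeWave ξ θ x : ℝ) : ℂ) + Complex.I * (planeWave ξ (θ + Real.pi / 2) x : ℝ) := by
      simp only [planeWave, ← add_assoc, Real.cos_add_pi_div_two]
      rw [← Complex.exp_add, ← add_mul,
        show -(θ : ℂ) + ↑(-2 * Real.pi * inner ℝ x ξ) =
          ((-(2 * Real.pi * inner ℝ x ξ + θ) : ℝ) : ℂ) by push_cast; ring,
        Complex.exp_mul_I, ← Complex.ofReal_cos, ← Complex.ofReal_sin, Real.cos_neg, Real.sin_neg]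
      push_cast
      ring
    rw [smul_eq_mul, ← mul_assoc, this]
    push_cast
    ring
  · exact (integrable_mul_planeWave hu ξ θ).ofReal
  · exact (integrable_mul_planeWave hu ξ _).ofReal.const_mul _

/-- If `∂ᵢⁿ u = ± g` weakly when tested against plane waves, then `ξᵢⁿ 𝓕 u` is a constant multiple
of `𝓕 g`. -/
theorem pow_mul_fourier_eq {u g : EuclideanSpace ℝ (Fin d) → ℝ} (hu : Integrable u)
    (hg : Integrable g) (i : Fin d) (n : ℕ)
    (h : ∀ ξ θ, ∫ x, u x * (partialDeriv i)^[n] (planeWave ξ θ) x = ∫ x, g x * planeWave ξ θ x)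
    (ξ : EuclideanSpace ℝ (Fin d)) :
    ((ξ i ^ n : ℝ) : ℂ) * 𝓕 (fun x => (u x : ℂ)) ξ =
      (((2 * Real.pi) ^ n : ℝ) : ℂ)⁻¹ * Complex.exp ((n * (Real.pi / 2) : ℝ) * Complex.I) *
        𝓕 (fun x => (g x : ℂ)) ξ := by
  have h' : ∀ θ, (2 * Real.pi * ξ i) ^ n * ∫ x, u x * planeWave ξ (θ + n * (Real.pi / 2)) x =
      ∫ x, g x * planeWave ξ θ x := fun θ => by
    rw [← h ξ θ, ← integral_const_mul, iterate_partialDeriv_planeWave]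
    congr 1
    ext x
    ring
  have h1 := integral_mul_planeWave_add hg ξ 0
  have h2 := integral_mul_planeWave_add hu ξ (0 + n * (Real.pi / 2))
  rw [← h' 0, ← h' (0 + Real.pi / 2), add_right_comm] at h1
  rw [zero_add] at h2
  simp only [zero_add, Complex.ofReal_zero, neg_zero, zero_mul, Complex.exp_zero, one_mul] at h1
  rw [← h1]
  -- Multiplying by this exponential undoes the phase accumulated over `n` derivatives.
  have h3 := congrArg (fun z => Complex.exp ((n * (Real.pi / 2) : ℝ) * Complex.I) * z) h2
  simp only [← mul_assoc, ← Complex.exp_add, neg_mul, add_neg_cancel, Complex.exp_zero,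
    one_mul] at h3
  rw [← h3]
  have hpi : (Real.pi : ℂ) ≠ 0 := by exact_mod_cast Real.pi_ne_zero
  push_cast
  field_simp
  ring

end Waves

/-! ### Cutting off weak derivatives. -/

section Localization

variable {d : ℕ} {X : Opens (EuclideanSpace ℝ (Fin d))}

theorem mixedPartial_single (i : Fin d) (n : ℕ) (φ : EuclideanSpace ℝ (Fin d) → ℝ) :
    mixedPartial (Pi.single i n) φ = (partialDeriv i)^[n] φ := by
  -- Without `Nodup`, a repeated `i` would apply the iterate more than once.
  have key : ∀ l : List (Fin d), l.Nodup →
      l.foldr (fun j ψ => (partialDeriv j)^[(Pi.single i n : Fin d → ℕ) j] ψ) φ =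
        if i ∈ l then (partialDeriv i)^[n] φ else φ := by
    intro l hl
    induction l with
    | nil => simp
    | cons j l ih =>
      rw [List.nodup_cons] at hl
      rw [List.foldr_cons, ih hl.2]
      rcases eq_or_ne j i with rfl | hj
      · simp [hl.1]
      · simp [hj.symm, hj]
  rw [mixedPartial, key _ (List.nodup_finRange d), if_pos (List.mem_finRange i)]

theorem contDiff_iterate_partialDeriv {φ : EuclideanSpace ℝ (Fin d) → ℝ} (i : Fin d)
    (h : ContDiff ℝ ∞ φ) (n : ℕ) : ContDiff ℝ ∞ ((partialDeriv i)^[n] φ) := by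
  induction n with
  | zero => exact h
  | succ n ih => rw [Function.iterate_succ_apply']; exact contDiff_partialDeriv i ih

theorem IsTestFunction.mul {χ φ : EuclideanSpace ℝ (Fin d) → ℝ} (hχ : IsTestFunction X χ)
    (hφ : ContDiff ℝ ∞ φ) : IsTestFunction X fun x => χ x * φ x :=
  ⟨hχ.smooth.mul hφ, hχ.compact.mul_right, (tsupport_mul_subset_left).trans hχ.subset⟩

theorem partialDeriv_mul (i : Fin d) {χ φ : EuclideanSpace ℝ (Fin d) → ℝ}
    (hχ : ContDiff ℝ ∞ χ) (hφ : ContDiff ℝ ∞ φ) (x : EuclideanSpace ℝ (Fin d)) :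
    partialDeriv i (fun x => χ x * φ x) x =
      χ x * partialDeriv i φ x + partialDeriv i χ x * φ x := by
  simp only [partialDeriv]
  rw [fderiv_fun_mul (hχ.differentiable (by simp) x) (hφ.differentiable (by simp) x)]
  simp [mul_comm]

/-- Consecutive pure weak derivatives are weak derivatives of each other. -/
theorem HasWeakDeriv.integral_mul_partialDeriv {i : Fin d} {m : ℕ} {f g g' : L2 X}
    (hg : HasWeakDeriv X (Pi.single i m) f g) (hg' : HasWeakDeriv X (Pi.single i (m + 1)) f g')
    {φ : EuclideanSpace ℝ (Fin d) → ℝ} (hφ : IsTestFunction X φ) :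
    ∫ x in (X : Set (EuclideanSpace ℝ (Fin d))), g x * partialDeriv i φ x =
      -∫ x in (X : Set (EuclideanSpace ℝ (Fin d))), g' x * φ x := by
  have h1 := hg _ (hφ.partialDeriv i)
  have h2 := hg' _ hφ
  rw [mixedPartial_single] at h1 h2
  rw [Function.iterate_succ_apply, h1, Finset.sum_pi_single', Finset.sum_pi_single'] at h2
  simp only [Finset.mem_univ, if_true, pow_succ, mul_assoc] at h2
  have := mul_left_cancel₀ (pow_ne_zero _ (by norm_num : (-1 : ℝ) ≠ 0)) h2
  linarith

/-- The extension by zero of `χ f` is square integrable. -/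
theorem IsTestFunction.memLp_indicator_mul {χ : EuclideanSpace ℝ (Fin d) → ℝ}
    (hχ : IsTestFunction X χ) (f : L2 X) :
    MemLp (fun x => (X : Set (EuclideanSpace ℝ (Fin d))).indicator f x * χ x) 2 := by
  obtain ⟨C, hC⟩ := hχ.compact.exists_bound_of_continuous hχ.smooth.continuous
  have hf : MemLp ((X : Set (EuclideanSpace ℝ (Fin d))).indicator f) 2 :=
    (memLp_indicator_iff_restrict X.isOpen.measurableSet).mpr (Lp.memLp f)
  refine hf.of_le_mul (c := C) (hf.1.mul hχ.smooth.continuous.aestronglyMeasurable)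
    (.of_forall fun x => ?_)
  rw [norm_mul, mul_comm]
  gcongr
  exact hC x

/-- On a set of finite measure L² is contained in L¹. This makes Fourier integrals and pairings with
bounded functions meaningful for cut-off functions. -/
theorem integrable_of_memLp_two_of_eq_zero {K : Set (EuclideanSpace ℝ (Fin d))} (hK : IsCompact K)
    {g : EuclideanSpace ℝ (Fin d) → ℝ} (hg : MemLp g 2) (h0 : ∀ x ∉ K, g x = 0) :
    Integrable g := by
  have : IsFiniteMeasure (volume.restrict K) := ⟨by simpa using hK.measure_lt_top⟩
  have h1 : IntegrableOn g K := (hg.restrict K).integrable (by norm_num)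
  exact (integrableOn_iff_integrable_of_support_subset fun x hx => by
    by_contra hxK
    exact hx (h0 x hxK)).mp h1

/-- Cutting off: if `h 0, h 1, …, h k` are successive weak derivatives in direction `i`, then the
cut-off function `χ * h m` has all weak derivatives in direction `i` of order at most `k - m` on the
whole space, also when tested against bounded smooth functions. -/
theorem exists_memLp_integral_mul_iterate_partialDeriv {i : Fin d} {k : ℕ} {h : ℕ → L2 X}
    (hh : ∀ m < k, ∀ φ, IsTestFunction X φ →
      ∫ x in (X : Set (EuclideanSpace ℝ (Fin d))), h m x * partialDeriv i φ x =
        -∫ x in (X : Set (EuclideanSpace ℝ (Fin d))), h (m + 1) x * φ x)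
    (n : ℕ) : ∀ (m : ℕ) (χ : EuclideanSpace ℝ (Fin d) → ℝ), m + n ≤ k → IsTestFunction X χ →
      ∃ g : EuclideanSpace ℝ (Fin d) → ℝ, MemLp g 2 ∧ (∀ x ∉ tsupport χ, g x = 0) ∧
        ∀ φ : EuclideanSpace ℝ (Fin d) → ℝ, ContDiff ℝ ∞ φ → (∃ C, ∀ x, ‖φ x‖ ≤ C) →
          ∫ x in (X : Set (EuclideanSpace ℝ (Fin d))),
            h m x * (χ x * (partialDeriv i)^[n] φ x) = ∫ x, g x * φ x := by
  induction n with
  | zero =>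
    intro m χ _ hχ
    refine ⟨_, hχ.memLp_indicator_mul (h m), fun x hx => ?_, fun φ _ _ => ?_⟩
    · rw [image_eq_zero_of_notMem_tsupport hx, mul_zero]
    · rw [← integral_indicator X.isOpen.measurableSet]
      congr 1
      ext x
      by_cases hx : x ∈ (X : Set (EuclideanSpace ℝ (Fin d))) <;> simp [hx, mul_assoc]
  | succ n ih =>
    intro m χ hmn hχ
    obtain ⟨g₁, hg₁, hs₁, h₁⟩ := ih (m + 1) χ (by omega) hχ
    -- The Leibniz term carries `∂ᵢ χ` in place of `χ`, which is why the induction ranges over all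
    -- cut-offs.
    obtain ⟨g₂, hg₂, hs₂, h₂⟩ := ih m (partialDeriv i χ) (by omega) (hχ.partialDeriv i)
    have hs₂' : ∀ x ∉ tsupport χ, g₂ x = 0 := fun x hx =>
      hs₂ x fun hx' => hx (tsupport_partialDeriv_subset i hx')
    refine ⟨fun x => -g₁ x - g₂ x, hg₁.neg.sub hg₂, fun x hx => ?_, fun φ hφ hb => ?_⟩
    · simp [hs₁ x hx, hs₂' x hx]
    · obtain ⟨C, hC⟩ := hb
      have hψ := contDiff_iterate_partialDeriv i hφ n
      have hi₁ : Integrable fun x => g₁ x * φ x :=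
        (integrable_of_memLp_two_of_eq_zero hχ.compact hg₁ hs₁).mul_bdd (c := C)
          hφ.continuous.aestronglyMeasurable (.of_forall hC)
      have hi₂ : Integrable fun x => g₂ x * φ x :=
        (integrable_of_memLp_two_of_eq_zero hχ.compact hg₂ hs₂').mul_bdd (c := C)
          hφ.continuous.aestronglyMeasurable (.of_forall hC)
      have e : ∀ x, h m x * (χ x * (partialDeriv i)^[n + 1] φ x) =
          h m x * partialDeriv i (fun x => χ x * (partialDeriv i)^[n] φ x) x -
            h m x * (partialDeriv i χ x * (partialDeriv i)^[n] φ x) := fun x => by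
        rw [Function.iterate_succ_apply', partialDeriv_mul i hχ.smooth hψ]
        ring
      simp_rw [e, sub_mul, neg_mul]
      rw [integral_sub (((hχ.mul hψ).partialDeriv i).integrable_mul _)
        (((hχ.partialDeriv i).mul hψ).integrable_mul _), hh m (by omega) _ (hχ.mul hψ),
        h₁ φ hφ ⟨C, hC⟩, h₂ φ hφ ⟨C, hC⟩, ← integral_neg, ← integral_sub hi₁.fun_neg hi₂]

end Localization

end Sobolev

/-! ### The Sobolev embedding. -/

namespace Sobolev

namespace SobolevSpace

open FourierTransform

variable {d k : ℕ} {X : Opens (EuclideanSpace ℝ (Fin d))}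

/-- Near every point of `X`, an element of `W^{k,2}(X)` with `k > d / 2` agrees almost everywhere
with a continuous function. -/
theorem exists_continuous_ae_eq_ball (hk : d < 2 * k) (f : SobolevSpace k X)
    {x₀ : EuclideanSpace ℝ (Fin d)} (hx₀ : x₀ ∈ X) :
    ∃ r > 0, Metric.ball x₀ r ⊆ X ∧ ∃ G : EuclideanSpace ℝ (Fin d) → ℝ, Continuous G ∧
      ∀ᵐ x, x ∈ Metric.ball x₀ r → toL2 f x = G x := by
  obtain ⟨R, hR, hRX⟩ := Metric.isOpen_iff.mp X.isOpen x₀ hx₀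
  -- The bump is `1` on the ball of radius `R / 4`, where the conclusion is claimed, and its
  -- support, of radius `R / 2`, stays inside `X`.
  let χ : ContDiffBump x₀ := ⟨R / 4, R / 2, by positivity, by linarith⟩
  have hχ : IsTestFunction X χ := ⟨χ.contDiff, χ.hasCompactSupport, by
    rw [χ.tsupport_eq]
    exact (Metric.closedBall_subset_ball (half_lt_self hR)).trans hRX⟩
  refine ⟨R / 4, by positivity, (Metric.ball_subset_ball (by linarith)).trans hRX, ?_⟩
  set u : EuclideanSpace ℝ (Fin d) → ℝ :=
    fun x => (X : Set (EuclideanSpace ℝ (Fin d))).indicator (toL2 f) x * χ x with hu_def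
  have hu2 : MemLp u 2 := hχ.memLp_indicator_mul (toL2 f)
  have hu : Integrable u := integrable_of_memLp_two_of_eq_zero hχ.compact hu2 fun x hx => by
    simp [hu_def, image_eq_zero_of_notMem_tsupport hx]
  have hpure : ∀ i, ∃ g : EuclideanSpace ℝ (Fin d) → ℝ, MemLp g 2 ∧ Integrable g ∧
      ∀ ξ θ, ∫ x, u x * (partialDeriv i)^[k] (planeWave ξ θ) x = ∫ x, g x * planeWave ξ θ x := by
    intro i
    have hsum : ∀ m ≤ k, ∑ j, (Pi.single i m : Fin d → ℕ) j ≤ k := fun m hm => by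
      rw [Finset.sum_pi_single']
      simpa using hm
    obtain ⟨g, hg2, hg0, hg⟩ := exists_memLp_integral_mul_iterate_partialDeriv (i := i) (k := k)
      (h := fun m => weakDeriv (Pi.single i m) f)
      (fun m hm φ hφ => (hasWeakDeriv_weakDeriv (hsum m hm.le) f).integral_mul_partialDeriv
        (hasWeakDeriv_weakDeriv (hsum (m + 1) hm) f) hφ) k 0 χ (by omega) hχ
    refine ⟨g, hg2, integrable_of_memLp_two_of_eq_zero hχ.compact hg2 hg0, fun ξ θ => ?_⟩
    rw [← hg _ (contDiff_planeWave ξ θ) ⟨1, abs_planeWave_le_one ξ θ⟩, Pi.single_zero,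
      weakDeriv_zero, ← integral_indicator X.isOpen.measurableSet]
    congr 1
    ext x
    by_cases hx : x ∈ (X : Set (EuclideanSpace ℝ (Fin d))) <;> simp [hu_def, hx, mul_assoc]
  have hF : Integrable (𝓕 fun x => (u x : ℂ)) := by
    refine Integrable.of_memLp_two_pow_mul hk (hu2.ofReal.fourier_two hu.ofReal) fun i => ?_
    obtain ⟨g, hg2, hg1, hg⟩ := hpure i
    simp_rw [pow_mul_fourier_eq hu hg1 i k hg]
    exact (hg2.ofReal.fourier_two hg1.ofReal).const_mul _
  refine ⟨fun x => (𝓕⁻ (𝓕 fun x => (u x : ℂ)) x).re,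
    Complex.continuous_re.comp (Real.continuous_fourierInv hF), ?_⟩
  have hinv : 𝓕⁻ (𝓕 fun x => (u x : ℂ)) =ᵐ[volume] fun x => (u x : ℂ) :=
    hu.ofReal.fourierInv_fourier_ae_eq hF
  filter_upwards [hinv] with x hx hxr
  have hxX : x ∈ (X : Set (EuclideanSpace ℝ (Fin d))) :=
    hRX (Metric.ball_subset_ball (by linarith) hxr)
  have hχx : χ x = 1 := χ.one_of_mem_closedBall (Metric.ball_subset_closedBall hxr)
  rw [hx]
  simp [hu_def, hxX, hχx]

/-- The Sobolev embedding: for `k > d / 2` the elements of `W^{k,2}(X)` have continuous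
representatives. -/
theorem exists_continuousOn_ae_eq (hk : d < 2 * k) (f : SobolevSpace k X) :
    ∃ F : EuclideanSpace ℝ (Fin d) → ℝ, ContinuousOn F X ∧
      toL2 f =ᵐ[volume.restrict (X : Set (EuclideanSpace ℝ (Fin d)))] F := by
  choose! r hr hrX G hG hfG using fun x₀ (hx₀ : x₀ ∈ X) => exists_continuous_ae_eq_ball hk f hx₀
  -- On an overlap of balls two local representatives are continuous and almost everywhere equal,
  -- hence equal; the diagonal `G y y` is thus well glued.
  have hloc : ∀ x ∈ X, Set.EqOn (fun y => G y y) (G x) (Metric.ball x (r x)) := by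
    intro x hx y hy
    have hyX : y ∈ X := hrX x hx hy
    refine Measure.eqOn_open_of_ae_eq (μ := volume)
      (U := Metric.ball x (r x) ∩ Metric.ball y (r y)) ?_
      (Metric.isOpen_ball.inter Metric.isOpen_ball) (hG y hyX).continuousOn (hG x hx).continuousOn
      ⟨hy, Metric.mem_ball_self (hr y hyX)⟩
    rw [Filter.EventuallyEq, ae_restrict_iff' (Metric.isOpen_ball.inter
      Metric.isOpen_ball).measurableSet]
    filter_upwards [hfG x hx, hfG y hyX] with z hzx hzy hz
    rw [← hzx hz.1, ← hzy hz.2]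
  refine ⟨fun y => G y y, fun x hx => ?_, ?_⟩
  · exact ((hG x hx).continuousAt.congr (Filter.eventuallyEq_of_mem
      (Metric.ball_mem_nhds x (hr x hx)) (hloc x hx).symm)).continuousWithinAt
  · rw [Filter.EventuallyEq, ae_restrict_iff' X.isOpen.measurableSet, ae_iff]
    -- There are uncountably many balls; a Lindelöf argument reduces to null sets near each point.
    refine measure_null_of_locally_null _ fun x hx => ?_
    have hxX : x ∈ X := by
      by_contra h
      exact hx fun h' => absurd h' h
    refine ⟨Metric.ball x (r x) ∩ {y | ¬(y ∈ X → toL2 f y = G y y)}, Filter.inter_mem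
      (mem_nhdsWithin_of_mem_nhds (Metric.ball_mem_nhds x (hr x hxX))) self_mem_nhdsWithin, ?_⟩
    refine measure_mono_null (fun y hy => ?_) (ae_iff.mp (hfG x hxX))
    intro h
    refine hy.2 fun _ => ?_
    rw [h hy.1]
    exact (hloc x hxX hy.1).symm

/-! ### Point evaluations and the reproducing kernel. -/

section Representative

variable (hk : d < 2 * k)

/-- The continuous representative of an element of `W^{k,2}(X)`, for `k > d / 2`. -/
noncomputable def continuousRep (f : SobolevSpace k X) : EuclideanSpace ℝ (Fin d) → ℝ :=
  (exists_continuousOn_ae_eq hk f).choose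

theorem continuousOn_continuousRep (f : SobolevSpace k X) : ContinuousOn (continuousRep hk f) X :=
  (exists_continuousOn_ae_eq hk f).choose_spec.1

theorem continuousRep_ae_eq (f : SobolevSpace k X) :
    toL2 f =ᵐ[volume.restrict (X : Set (EuclideanSpace ℝ (Fin d)))] continuousRep hk f :=
  (exists_continuousOn_ae_eq hk f).choose_spec.2

/-- The representative is chosen arbitrarily; this uniqueness on `X` is what makes evaluation
linear. -/
theorem continuousRep_eqOn {f : SobolevSpace k X} {F : EuclideanSpace ℝ (Fin d) → ℝ}
    (hF : ContinuousOn F X)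
    (h : toL2 f =ᵐ[volume.restrict (X : Set (EuclideanSpace ℝ (Fin d)))] F) :
    Set.EqOn (continuousRep hk f) F X :=
  Measure.eqOn_open_of_ae_eq ((continuousRep_ae_eq hk f).symm.trans h) X.isOpen
    (continuousOn_continuousRep hk f) hF

/-- Evaluation of the continuous representative at a point of `X`. -/
noncomputable def evalₗ (x : X) : SobolevSpace k X →ₗ[ℝ] ℝ where
  toFun f := continuousRep hk f x
  map_add' f g := by
    refine continuousRep_eqOn hk ((continuousOn_continuousRep hk f).add
      (continuousOn_continuousRep hk g)) ?_ x.2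
    rw [map_add]
    exact (Lp.coeFn_add _ _).trans ((continuousRep_ae_eq hk f).add (continuousRep_ae_eq hk g))
  map_smul' c f := by
    refine continuousRep_eqOn hk ((continuousOn_continuousRep hk f).const_smul c) ?_ x.2
    rw [map_smul]
    exact (Lp.coeFn_smul _ _).trans ((continuousRep_ae_eq hk f).const_smul c)

/-- Integration over a set of finite measure is a continuous linear functional. -/
theorem exists_clm_eq_setIntegral_toL2 {B : Set (EuclideanSpace ℝ (Fin d))} (hB : MeasurableSet B)
    (hBfin : volume B ≠ ⊤) : ∃ A : SobolevSpace k X →L[ℝ] ℝ, ∀ f,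
      A f = ∫ y in (X : Set (EuclideanSpace ℝ (Fin d))) ∩ B, toL2 f y := by
  have hfin : volume.restrict (X : Set (EuclideanSpace ℝ (Fin d))) B ≠ ⊤ :=
    ((Measure.restrict_apply_le _ _).trans_lt hBfin.lt_top).ne
  refine ⟨(innerSL ℝ (indicatorConstLp 2 hB hfin (1 : ℝ))).comp ⟨toL2, continuous_toL2⟩,
    fun f => ?_⟩
  rw [Set.inter_comm, ← Measure.restrict_restrict hB]
  exact L2.inner_indicatorConstLp_one hB hfin (toL2 f)

/-- The value of the continuous representative is the limit of its averages over small balls. -/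
theorem tendsto_average_ball (f : SobolevSpace k X) (x : X) :
    Filter.Tendsto (fun r : ℝ => (volume.real (Metric.ball (x : EuclideanSpace ℝ (Fin d)) r))⁻¹ *
        ∫ y in (X : Set (EuclideanSpace ℝ (Fin d))) ∩ Metric.ball (x : EuclideanSpace ℝ (Fin d)) r,
          toL2 f y) (nhdsWithin 0 (Set.Ioi 0)) (nhds (continuousRep hk f x)) := by
  rw [Metric.tendsto_nhds]
  intro ε hε
  have hcont : ContinuousAt (continuousRep hk f) x :=
    (continuousOn_continuousRep hk f).continuousAt (X.isOpen.mem_nhds x.2)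
  obtain ⟨δ, hδ, hδ'⟩ := Metric.eventually_nhds_iff_ball.mp
    ((X.isOpen.eventually_mem x.2).and (hcont.eventually (Metric.ball_mem_nhds _ (half_pos hε))))
  filter_upwards [Ioo_mem_nhdsGT hδ] with r hr
  have hsub : Metric.ball (x : EuclideanSpace ℝ (Fin d)) r ⊆ Metric.ball x δ :=
    Metric.ball_subset_ball hr.2.le
  have hBX : Metric.ball (x : EuclideanSpace ℝ (Fin d)) r ⊆ X := fun y hy => (hδ' y (hsub hy)).1
  rw [Set.inter_eq_right.mpr hBX]
  set B := Metric.ball (x : EuclideanSpace ℝ (Fin d)) r with hB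
  have hBfin : volume B < ⊤ := measure_ball_lt_top
  have hBpos : 0 < volume.real B :=
    ENNReal.toReal_pos (Metric.measure_ball_pos volume _ hr.1).ne' hBfin.ne
  have hint : ∫ y in B, toL2 f y = ∫ y in B, continuousRep hk f y :=
    integral_congr_ae (ae_restrict_of_ae_restrict_of_subset hBX (continuousRep_ae_eq hk f))
  have hfin : IsFiniteMeasure (volume.restrict B) := ⟨by simpa using hBfin⟩
  -- The non-strict bound passes to the average; the factor `1 / 2` then leaves a strict bound by
  -- `ε`.
  have hbound : ∀ y ∈ B, ‖continuousRep hk f y - continuousRep hk f x‖ ≤ ε / 2 := fun y hy =>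
    (mem_ball_iff_norm.mp (hδ' y (hsub hy)).2).le
  have hI : IntegrableOn (continuousRep hk f) B := by
    have h1 : MemLp (toL2 f) 2 (volume.restrict B) :=
      (Lp.memLp (toL2 f)).mono_measure (Measure.restrict_mono hBX le_rfl)
    exact (h1.integrable (by norm_num)).congr
      (ae_restrict_of_ae_restrict_of_subset hBX (continuousRep_ae_eq hk f))
  have key := norm_setIntegral_le_of_norm_le_const hBfin hbound
  rw [integral_sub hI (integrable_const _), setIntegral_const, smul_eq_mul] at key
  rw [hint, Real.dist_eq]
  have e : (volume.real B)⁻¹ * ∫ y in B, continuousRep hk f y =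
      (volume.real B)⁻¹ * ((∫ y in B, continuousRep hk f y) -
        volume.real B * continuousRep hk f x) + continuousRep hk f x := by
    field_simp
    ring
  rw [e, add_sub_cancel_right, abs_mul, abs_inv, abs_of_pos hBpos, inv_mul_lt_iff₀ hBpos]
  rw [Real.norm_eq_abs] at key
  nlinarith

/-- Banach–Steinhaus: a pointwise limit of continuous functionals on a complete space is continuous.
This is where `completeSpace` enters. -/
theorem continuous_evalₗ (x : X) : Continuous (evalₗ hk x : SobolevSpace k X →ₗ[ℝ] ℝ) := by
  choose A hA using fun r : ℝ => exists_clm_eq_setIntegral_toL2 (k := k) (X := X)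
    (B := Metric.ball (x : EuclideanSpace ℝ (Fin d)) r) measurableSet_ball measure_ball_lt_top.ne
  have h : Filter.Tendsto (fun (r : ℝ) (f : SobolevSpace k X) =>
      ((volume.real (Metric.ball (x : EuclideanSpace ℝ (Fin d)) r))⁻¹ • A r) f)
      (nhdsWithin 0 (Set.Ioi 0)) (nhds (evalₗ hk x)) := by
    refine tendsto_pi_nhds.mpr fun f => ?_
    simp only [smul_apply, smul_eq_mul, hA]
    exact tendsto_average_ball hk f x
  exact (continuousLinearMapOfTendsto _ h).continuous

variable (k X) in
/-- The space `W^{k,2}(X)`, for `k > d / 2`, as a space of continuous functions on `X` with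
continuous point evaluations. -/
@[reducible]
noncomputable def rkhs : RKHS ℝ (SobolevSpace k X) X ℝ where
  -- The target `X → ℝ` has the product topology, so continuity of each evaluation suffices.
  coeCLM := ContinuousLinearMap.pi fun x => ⟨evalₗ hk x, continuous_evalₗ hk x⟩
  coeCLM_injective f g h := by
    refine toL2_injective (Lp.ext ?_)
    have h' : ∀ x ∈ (X : Set (EuclideanSpace ℝ (Fin d))),
        continuousRep hk f x = continuousRep hk g x := fun x hx => congrFun h ⟨x, hx⟩
    filter_upwards [continuousRep_ae_eq hk f, continuousRep_ae_eq hk g,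
      ae_restrict_mem X.isOpen.measurableSet] with x hf hg hx
    rw [hf, hg, h' x hx]

end Representative

end SobolevSpace

end Sobolev

theorem theoremB (d k : ℕ) (hk : (d : ℝ) / 2 < (k : ℝ))
    (X : TopologicalSpace.Opens (EuclideanSpace ℝ (Fin d)))
    (hXconn : IsConnected (X : Set (EuclideanSpace ℝ (Fin d))))
    (hXbdd : Bornology.IsBounded (X : Set (EuclideanSpace ℝ (Fin d)))) :
    -- `W^{k,2}(X)` is a Hilbert space
    CompleteSpace (Sobolev.SobolevSpace k X) ∧
    -- its elements are functions on `X`, with continuous point evaluations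
    ∃ R : RKHS ℝ (Sobolev.SobolevSpace k X) X ℝ,
      -- `R.coeCLM f : X → ℝ` is the continuous representative of the class `f`
      (∀ f : Sobolev.SobolevSpace k X, Continuous (R.coeCLM f) ∧
        ∀ᵐ x ∂(MeasureTheory.volume : MeasureTheory.Measure (EuclideanSpace ℝ (Fin d))),
          ∀ hx : x ∈ X, R.coeCLM f ⟨x, hx⟩ = Sobolev.SobolevSpace.toL2 f x) ∧
      -- the point evaluations are bounded
      (∀ x : X, ∃ M : ℝ, 0 < M ∧
        ∀ f : Sobolev.SobolevSpace k X, |R.coeCLM f x| ≤ M * ‖f‖) ∧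
      -- there is a reproducing kernel
      ∃ K : X → Sobolev.SobolevSpace k X,
        ∀ (f : Sobolev.SobolevSpace k X) (x : X), R.coeCLM f x = inner ℝ f (K x) := by
  have hk' : d < 2 * k := by
    rw [div_lt_iff₀ two_pos] at hk
    have : d < k * 2 := by exact_mod_cast hk
    omega
  refine ⟨inferInstance, Sobolev.SobolevSpace.rkhs k X hk', fun f => ⟨?_, ?_⟩, fun x => ?_, ?_⟩
  · exact continuousOn_iff_continuous_domRestrict.mp
      (Sobolev.SobolevSpace.continuousOn_continuousRep hk' f)
  · filter_upwards [(ae_restrict_iff' X.isOpen.measurableSet).mp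
      (Sobolev.SobolevSpace.continuousRep_ae_eq hk' f)] with x hx hxX
    exact (hx hxX).symm
  · obtain ⟨M, hM, h⟩ := ContinuousLinearMap.bound
      (⟨Sobolev.SobolevSpace.evalₗ hk' x, Sobolev.SobolevSpace.continuous_evalₗ hk' x⟩ :
        Sobolev.SobolevSpace k X →L[ℝ] ℝ)
    exact ⟨M, hM, h⟩
  · let _ := Sobolev.SobolevSpace.rkhs k X hk'
    -- The values are scalars, so the kernel vector is the kernel map at `x` applied to `1`.
    refine ⟨fun x => RKHS.kerFun (Sobolev.SobolevSpace k X) x 1, fun f x => ?_⟩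
    rw [RKHS.inner_kerFun]
    simp
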